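/- Let $\mathbb{F}$ be a field of characteristic $0$, let $n\ge 1$ be an integer, and let $W_n=\mathrm{Der}_{\mathbb{F}}\big(\mathbb{F}[t_1^{\pm1},\ldots,t_n^{\pm1}]\big)$ be the Witt algebra, that is, the Lie algebra over $\mathbb{F}$ of all $\mathbb{F}$-linear derivations of the Laurent polynomial algebra in $n$ variables, with the commutator bracket. An automorphism of $W_n$ is an invertible $\mathbb{F}$-linear map $\theta: W_n\to W_n$ with $\theta([x,y])=[\theta(x),\theta(y)]$ for all $x,y\in W_n$. (a) Every $2$-local automorphism of $W_n$ is an automorphism: if $\Phi: W_n\to W_n$ is a map (not assumed to be linear, injective or surjective) such that for all $x,y\in W_n$ there is an automorphism $\theta_{x,y}$ of $W_n$ with $\Phi(x)=\theta_{x,y}(x)$ and $\Phi(y)=\theta_{x,y}(y)$, then $\Phi$ is an automorphism of $W_n$. (b) Every local automorphism of $W_n$ is an automorphism: if $\Phi: W_n\to W_n$ is an $\mathbb{F}$-linear map (not assumed to be injective or surjective) such that for every $x\in W_n$ there is an automorphism $\theta_x$ of $W_n$ with $\Phi(x)=\theta_x(x)$, then $\Phi$ is an automorphism of $W_n$. 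-/

import Mathlib

/-- The Laurent polynomial algebra `F[t₁^{±1}, …, tₙ^{±1}]`, as the group algebra of `ℤⁿ`:
the monomial `t^α` is `AddMonoidAlgebra.single α 1`. -/
abbrev MvLaurentPolynomial (F : Type*) [Field F] (n : ℕ) : Type _ :=
  AddMonoidAlgebra F (Fin n → ℤ)

/-- The Witt algebra `Wₙ = Der(F[t₁^{±1}, …, tₙ^{±1}])` of all `F`-derivations of the Laurent
polynomial algebra; its Lie bracket is the commutator `[D, E] = D ∘ E - E ∘ D`. -/
abbrev WittLieAlgebra (F : Type*) [Field F] (n : ℕ) : Type _ :=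
  Derivation F (MvLaurentPolynomial F n) (MvLaurentPolynomial F n)

/-- A map `Φ : L → L` (not assumed linear) is an automorphism of the Lie algebra `L`: it is the
underlying map of an invertible linear map that preserves the bracket. -/
def IsLieAutomorphism (F : Type*) {L : Type*} [CommRing F] [LieRing L] [LieAlgebra F L]
    (Φ : L → L) : Prop :=
  ∃ θ : L ≃ₗ⁅F⁆ L, ∀ x, Φ x = θ x

/-- A `2`-local automorphism of `L`: a map `Φ : L → L`, not necessarily linear, that agrees on
every pair of elements with some automorphism depending on the pair. -/
def IsTwoLocalAutomorphism (F : Type*) {L : Type*} [CommRing F] [LieRing L] [LieAlgebra F L]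
    (Φ : L → L) : Prop :=
  ∀ x y : L, ∃ θ : L ≃ₗ⁅F⁆ L, Φ x = θ x ∧ Φ y = θ y

/-- A local automorphism of `L`: a linear map `Φ : L → L` that agrees at every element with some
automorphism depending on the element. -/
def IsLocalAutomorphism (F : Type*) {L : Type*} [CommRing F] [LieRing L] [LieAlgebra F L]
    (Φ : L → L) : Prop :=
  IsLinearMap F Φ ∧ ∀ x : L, ∃ θ : L ≃ₗ⁅F⁆ L, Φ x = θ x

/-! Write `E α u` for `t^α D_u`. The degree-zero derivations are exactly the ad-locally finite ones
(`AdLocallyFinite.eq_E_zero`), so every automorphism preserves this torus. It therefore permutes the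
weight spaces, and the bracket relations leave only a scalar on each of them. Hence every
automorphism has the form `t^α D_u ↦ χ(α) t^{Mα} D_{Au}`, with `χ` a character and `A`, `M`
contragredient (`nonempty_normalForm`).

Let `S` be the origin together with the unit vectors, choose `w` taking distinct values on `S`, and
put `x = ∑ t^γ D_w` over `S`. An automorphism fixing `x` has `Aw = w` by the degree-zero component,
so `w · Mγ = w · γ` with `Mγ ∈ S`. Separation gives `Mγ = γ` and `χ(γ) = 1` on a basis of the
lattice, and the automorphism is the identity (`eq_self_of_map_sum_E`).

(a) All automorphisms agreeing with `Φ` at `x` coincide, so `Φ` is that single automorphism.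

(b) After composing with an automorphism, `Φ` fixes `x`. Linearity then shows that it fixes the
torus and each `t_i D_w`, and that it is a scalar on each weight space. Testing it on the same sum
over `S ∪ {α}` shows that the scalar at `α` is 1 (`local_eq_id`). -/

namespace WittLieAlgebra

/-! ### The pairing between vectors and lattice points. -/

section

variable {F : Type*} [Field F] {n : ℕ}

/-- The pairing `∑ uᵢ αᵢ` of a vector with a lattice point. -/
def pairing (u : Fin n → F) (α : Fin n → ℤ) : F := ∑ i, u i * (α i : F)

@[simp] lemma pairing_zero_left (α : Fin n → ℤ) : pairing (0 : Fin n → F) α = 0 := by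
  simp [pairing]

@[simp] lemma pairing_zero_right (u : Fin n → F) : pairing u 0 = 0 := by simp [pairing]

@[simp] lemma pairing_add_left (u v : Fin n → F) (α : Fin n → ℤ) :
    pairing (u + v) α = pairing u α + pairing v α := by
  simp [pairing, add_mul, Finset.sum_add_distrib]

@[simp] lemma pairing_smul_left (c : F) (u : Fin n → F) (α : Fin n → ℤ) :
    pairing (c • u) α = c * pairing u α := by
  simp [pairing, Finset.mul_sum, mul_assoc]

@[simp] lemma pairing_neg_left (u : Fin n → F) (α : Fin n → ℤ) :
    pairing (-u) α = -pairing u α := by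
  simp [pairing]

@[simp] lemma pairing_sub_left (u v : Fin n → F) (α : Fin n → ℤ) :
    pairing (u - v) α = pairing u α - pairing v α := by
  simp [sub_eq_add_neg]

@[simp] lemma pairing_add_right (u : Fin n → F) (α β : Fin n → ℤ) :
    pairing u (α + β) = pairing u α + pairing u β := by
  simp [pairing, mul_add, Finset.sum_add_distrib]

@[simp] lemma pairing_neg_right (u : Fin n → F) (α : Fin n → ℤ) :
    pairing u (-α) = -pairing u α := by
  simp [pairing]

@[simp] lemma pairing_sub_right (u : Fin n → F) (α β : Fin n → ℤ) :
    pairing u (α - β) = pairing u α - pairing u β := by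
  simp [sub_eq_add_neg]

@[simp] lemma pairing_nsmul_right (u : Fin n → F) (k : ℕ) (α : Fin n → ℤ) :
    pairing u (k • α) = k * pairing u α := by
  induction k with
  | zero => simp
  | succ k ih => rw [succ_nsmul, pairing_add_right, ih]; push_cast; ring

@[simp] lemma pairing_single_right (u : Fin n → F) (i : Fin n) :
    pairing u (Pi.single i 1) = u i := by
  simp [pairing, Pi.single_apply]

lemma pairing_single_left (α : Fin n → ℤ) (i : Fin n) :
    pairing (Pi.single i (1 : F)) α = α i := by
  simp [pairing, Pi.single_apply]

lemma pairing_intCast (w α : Fin n → ℤ) :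
    pairing (fun i => (w i : F)) α = ((∑ i, w i * α i : ℤ) : F) := by
  simp [pairing]

lemma eq_of_forall_pairing_eq [CharZero F] {α β : Fin n → ℤ}
    (h : ∀ u : Fin n → F, pairing u α = pairing u β) : α = β := by
  ext i
  have := h (Pi.single i 1)
  rw [pairing_single_left, pairing_single_left] at this
  exact_mod_cast this

lemma exists_pairing_ne_zero [CharZero F] {α : Fin n → ℤ} (h : α ≠ 0) :
    ∃ u : Fin n → F, pairing u α ≠ 0 := by
  by_contra! H
  exact h (eq_of_forall_pairing_eq (F := F) (by simpa using H))

lemma exists_pairing_right_ne_zero {u : Fin n → F} (h : u ≠ 0) :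
    ∃ α : Fin n → ℤ, pairing u α ≠ 0 := by
  obtain ⟨i, hi⟩ := Function.ne_iff.1 h
  exact ⟨Pi.single i 1, by simpa using hi⟩

/-- Finitely many nonzero lattice points avoid a common integral hyperplane. -/
lemma exists_int_sum_mul_ne_zero (S : Finset (Fin n → ℤ)) (hS : ∀ γ ∈ S, γ ≠ 0) :
    ∃ w : Fin n → ℤ, ∀ γ ∈ S, ∑ i, w i * γ i ≠ 0 := by
  -- Encode `γ` as the polynomial `∑ γ i X^i`. Then `w i = N ^ i` works for any `N` that is not a
  -- root of the product.
  let p : (Fin n → ℤ) → Polynomial ℤ := fun γ => ∑ i : Fin n, Polynomial.monomial (i : ℕ) (γ i)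
  have hp : ∀ γ ∈ S, p γ ≠ 0 := by
    intro γ hγ h0
    obtain ⟨i, hi⟩ := Function.ne_iff.1 (hS γ hγ)
    apply hi
    have := congrArg (fun q => Polynomial.coeff q (i : ℕ)) h0
    simpa [p, Polynomial.finsetSum_coeff, Polynomial.coeff_monomial, Fin.val_inj] using this
  have hprod : ∏ γ ∈ S, p γ ≠ 0 := Finset.prod_ne_zero_iff.2 hp
  obtain ⟨N, hN⟩ : ∃ N : ℤ, (∏ γ ∈ S, p γ).eval N ≠ 0 := by
    by_contra! H
    exact hprod (Polynomial.funext (by simpa using H))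
  refine ⟨fun i => N ^ (i : ℕ), fun γ hγ h0 => ?_⟩
  rw [Polynomial.eval_prod] at hN
  apply Finset.prod_ne_zero_iff.1 hN γ hγ
  simp only [p, Polynomial.eval_finsetSum, Polynomial.eval_monomial]
  rw [← h0]
  exact Finset.sum_congr rfl fun i _ => mul_comm _ _

/-- Some integral functional is injective on a given finite set of lattice points. -/
lemma exists_int_injOn (S : Finset (Fin n → ℤ)) :
    ∃ w : Fin n → ℤ, Set.InjOn (fun γ : Fin n → ℤ => ∑ i, w i * γ i) S := by
  classical
  obtain ⟨w, hw⟩ := exists_int_sum_mul_ne_zero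
    (((S ×ˢ S).image fun p => p.1 - p.2).filter (· ≠ 0)) (by simp)
  refine ⟨w, fun α hα β hβ h => ?_⟩
  by_contra hne
  refine hw (α - β) ?_ ?_
  · simp only [Finset.mem_filter, Finset.mem_image, Finset.mem_product]
    exact ⟨⟨(α, β), ⟨hα, hβ⟩, rfl⟩, sub_ne_zero.2 hne⟩
  · simpa [mul_sub, sub_eq_zero] using h

lemma exists_pairing_injOn [CharZero F] (S : Finset (Fin n → ℤ)) :
    ∃ w : Fin n → F, Set.InjOn (pairing w) (S : Set (Fin n → ℤ)) := by
  obtain ⟨w, hw⟩ := exists_int_injOn S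
  refine ⟨fun i => w i, fun α hα β hβ h => hw hα hβ ?_⟩
  rw [pairing_intCast, pairing_intCast] at h
  exact_mod_cast h

/-! ### Homogeneous derivations, their bracket and their components. -/

/-- The derivation `∑ uᵢ tᵢ ∂ᵢ` as a linear map. -/
noncomputable def eulerLinear (u : Fin n → F) :
    MvLaurentPolynomial F n →ₗ[F] MvLaurentPolynomial F n :=
  (AddMonoidAlgebra.coeffLinearEquiv F).symm.toLinearMap ∘ₗ
    (Finsupp.lsum F fun γ => pairing u γ • Finsupp.lsingle γ) ∘ₗ
    (AddMonoidAlgebra.coeffLinearEquiv F).toLinearMap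

lemma eulerLinear_single (u : Fin n → F) (γ : Fin n → ℤ) (c : F) :
    eulerLinear u (AddMonoidAlgebra.single γ c) =
      AddMonoidAlgebra.single γ (pairing u γ * c) := by
  ext1
  simp [eulerLinear]

/-- The derivation `∑ uᵢ tᵢ ∂ᵢ`. -/
noncomputable def euler (u : Fin n → F) : WittLieAlgebra F n :=
  Derivation.mk' (eulerLinear u) fun a b => by
    induction a using AddMonoidAlgebra.induction_linear with
    | zero => simp
    | add f g hf hg => simp only [add_mul, map_add, hf, hg, add_smul, smul_add]; abel
    | single α c =>
      induction b using AddMonoidAlgebra.induction_linear with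
      | zero => simp
      | add f g hf hg => simp only [mul_add, map_add, hf, hg, add_smul, smul_add]; abel
      | single β d =>
        simp only [AddMonoidAlgebra.single_mul_single, eulerLinear_single, smul_eq_mul,
          pairing_add_right]
        rw [add_comm β α, ← AddMonoidAlgebra.single_add]
        congr 1
        ring

/-- The derivation `t^α ∑ uᵢ tᵢ ∂ᵢ`. -/
noncomputable def E (α : Fin n → ℤ) : (Fin n → F) →ₗ[F] WittLieAlgebra F n where
  toFun u := (AddMonoidAlgebra.single α (1 : F) : MvLaurentPolynomial F n) • euler u
  map_add' u v := by
    ext1 x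
    induction x using AddMonoidAlgebra.induction_linear with
    | zero => simp
    | add f g hf hg => simp only [map_add, hf, hg]
    | single β d =>
      simp [euler, eulerLinear_single, add_mul, mul_add, AddMonoidAlgebra.single_add,
        AddMonoidAlgebra.single_mul_single]
  map_smul' c u := by
    ext1 x
    induction x using AddMonoidAlgebra.induction_linear with
    | zero => simp
    | add f g hf hg => simp only [map_add, hf, hg]
    | single β d =>
      simp [euler, eulerLinear_single, mul_assoc, AddMonoidAlgebra.single_mul_single]

@[simp] lemma E_single (α : Fin n → ℤ) (u : Fin n → F) (β : Fin n → ℤ) (c : F) :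
    E α u (AddMonoidAlgebra.single β c) =
      AddMonoidAlgebra.single (α + β) (pairing u β * c) := by
  simp [E, euler, eulerLinear_single, AddMonoidAlgebra.single_mul_single]

/-- A derivation is determined by its values on monomials. -/
lemma ext_monomial {x y : WittLieAlgebra F n}
    (h : ∀ α, x (AddMonoidAlgebra.single α 1) = y (AddMonoidAlgebra.single α 1)) : x = y := by
  ext1 f
  induction f using AddMonoidAlgebra.induction_linear with
  | zero => simp
  | add f g hf hg => simp only [map_add, hf, hg]
  | single β d =>
    have : (AddMonoidAlgebra.single β d : MvLaurentPolynomial F n) =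
        d • AddMonoidAlgebra.single β 1 := by simp
    rw [this, Derivation.map_smul, Derivation.map_smul, h]

/-- A set of lattice points that contains the unit vectors and is closed under addition and
negation is everything. -/
lemma lattice_induction {p : (Fin n → ℤ) → Prop} (single : ∀ i, p (Pi.single i 1))
    (zero : p 0) (add : ∀ α β, p α → p β → p (α + β)) (neg : ∀ α, p α → p (-α))
    (α : Fin n → ℤ) : p α := by
  have key : ∀ i (k : ℤ), p (Pi.single i k) := by
    intro i k
    induction k with
    | zero => simpa using zero
    | succ k ih => rw [Pi.single_add]; exact add _ _ ih (single i)
    | pred k ih =>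
      rw [sub_eq_add_neg, Pi.single_add, Pi.single_neg (f := fun _ => ℤ) i (1 : ℤ)]
      exact add _ _ ih (neg _ (single i))
  rw [← Finset.univ_sum_single α]
  exact Finset.sum_induction _ p add zero fun i _ => key i _

/-- A derivation is determined by its values on the variables. -/
lemma ext_variables {x y : WittLieAlgebra F n}
    (h : ∀ i, x (AddMonoidAlgebra.single (Pi.single i 1) 1) =
      y (AddMonoidAlgebra.single (Pi.single i 1) 1)) : x = y := by
  have one : (AddMonoidAlgebra.single (0 : Fin n → ℤ) (1 : F)) = 1 := rfl
  refine ext_monomial fun α => lattice_induction (p := fun α =>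
    x (AddMonoidAlgebra.single α 1) = y (AddMonoidAlgebra.single α 1)) h ?_ ?_ ?_ α
  · rw [one, Derivation.map_one_eq_zero, Derivation.map_one_eq_zero]
  · intro α β hα hβ
    have : (AddMonoidAlgebra.single (α + β) (1 : F)) =
        AddMonoidAlgebra.single α 1 * AddMonoidAlgebra.single β 1 := by
      rw [AddMonoidAlgebra.single_mul_single, one_mul]
    rw [this, Derivation.leibniz, Derivation.leibniz, hα, hβ]
  · intro α hα
    have h1 : (AddMonoidAlgebra.single (-α) (1 : F)) * AddMonoidAlgebra.single α 1 = 1 := by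
      rw [AddMonoidAlgebra.single_mul_single, one_mul, neg_add_cancel, one]
    rw [Derivation.leibniz_of_mul_eq_one x h1,
      Derivation.leibniz_of_mul_eq_one y h1, hα]

/-- The bracket of two homogeneous derivations. -/
lemma lie_E (α β : Fin n → ℤ) (u v : Fin n → F) :
    ⁅E α u, E β v⁆ = E (α + β) (pairing u β • v - pairing v α • u) := by
  refine ext_monomial fun γ => ?_
  simp only [Derivation.commutator_apply, E_single, pairing_add_right, pairing_sub_left,
    pairing_smul_left]
  rw [show β + (α + γ) = α + (β + γ) by abel, show α + β + γ = α + (β + γ) by abel,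
    ← AddMonoidAlgebra.single_sub]
  congr 1
  ring

/-- The component of degree `γ` of a derivation. -/
noncomputable def component (γ : Fin n → ℤ) : WittLieAlgebra F n →ₗ[F] (Fin n → F) where
  -- `E γ u` sends `t_i` to `u i` times the monomial of exponent `γ + e_i`, hence the shift.
  toFun x i := (x (AddMonoidAlgebra.single (Pi.single i 1) 1)).coeff (γ + Pi.single i 1)
  map_add' x y := by ext i; simp
  map_smul' c x := by ext i; simp

lemma component_E (γ α : Fin n → ℤ) (u : Fin n → F) :
    component γ (E α u) = if γ = α then u else 0 := by
  ext i
  simp only [component, LinearMap.coe_mk, AddHom.coe_mk, E_single, AddMonoidAlgebra.coeff_single,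
    Finsupp.single_apply, add_left_inj, pairing_single_right, mul_one]
  split_ifs <;> simp_all

@[simp] lemma component_E_self (γ : Fin n → ℤ) (u : Fin n → F) : component γ (E γ u) = u := by
  simp [component_E]

lemma component_E_of_ne {γ α : Fin n → ℤ} (h : γ ≠ α) (u : Fin n → F) :
    component γ (E α u) = 0 := by
  simp [component_E, h]

lemma E_injective (α : Fin n → ℤ) : Function.Injective (E (F := F) α) :=
  fun u v h => by simpa using congrArg (component α) h

lemma E_eq_zero_iff {α : Fin n → ℤ} {u : Fin n → F} : E α u = 0 ↔ u = 0 :=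
  map_eq_zero_iff _ (E_injective α)

lemma eq_of_E_eq {α β : Fin n → ℤ} {u v : Fin n → F} (h : E α u = E β v) (hu : u ≠ 0) :
    α = β := by
  by_contra hne
  apply hu
  simpa [component_E_of_ne hne] using congrArg (component α) h

lemma finite_component_ne_zero (x : WittLieAlgebra F n) : {γ | component γ x ≠ 0}.Finite := by
  classical
  refine Set.Finite.subset (Finset.finite_toSet (Finset.univ.biUnion fun i : Fin n =>
    (x (AddMonoidAlgebra.single (Pi.single i 1) 1)).coeff.support.image (· - Pi.single i 1))) ?_
  intro γ hγ
  obtain ⟨i, hi⟩ := Function.ne_iff.1 hγ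
  simp only [Finset.coe_biUnion, Finset.mem_coe, Finset.mem_univ, Set.iUnion_true, Set.mem_iUnion,
    Finset.mem_image]
  exact ⟨i, γ + Pi.single i 1, Finsupp.mem_support_iff.2 hi, by simp⟩

/-- The set of degrees in which a derivation has a nonzero component. -/
noncomputable def support (x : WittLieAlgebra F n) : Finset (Fin n → ℤ) :=
  (finite_component_ne_zero x).toFinset

@[simp] lemma mem_support {x : WittLieAlgebra F n} {γ : Fin n → ℤ} :
    γ ∈ support x ↔ component γ x ≠ 0 := by
  simp [support]

lemma sum_E_component (x : WittLieAlgebra F n) :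
    ∑ γ ∈ support x, E γ (component γ x) = x := by
  refine ext_variables fun i => ?_
  ext δ
  have : ((∑ γ ∈ support x, E γ (component γ x)) (AddMonoidAlgebra.single (Pi.single i 1) 1)) =
      ∑ γ ∈ support x, AddMonoidAlgebra.single (γ + Pi.single i 1) (component γ x i) := by
    rw [← Derivation.coeFnAddMonoidHom_apply, map_sum, Finset.sum_apply]
    simp
  rw [this, AddMonoidAlgebra.coeff_sum, Finset.sum_apply']
  simp only [AddMonoidAlgebra.coeff_single, Finsupp.single_apply]
  rw [Finset.sum_eq_single (δ - Pi.single i 1)]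
  · simp [component]
  · intro γ _ hne
    rw [if_neg]
    rintro rfl
    simp at hne
  · intro hγ
    simp only [mem_support, not_not] at hγ
    simp [hγ]

lemma ext_component {x y : WittLieAlgebra F n} (h : ∀ γ, component γ x = component γ y) :
    x = y := by
  rw [← sub_eq_zero, ← sum_E_component (x - y)]
  exact Finset.sum_eq_zero fun γ _ => by simp [h]

lemma linear_ext {V : Type*} [AddCommGroup V] [Module F V] {f g : WittLieAlgebra F n →ₗ[F] V}
    (h : ∀ α u, f (E α u) = g (E α u)) : f = g := by
  ext1 x
  rw [← sum_E_component x, map_sum, map_sum]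
  exact Finset.sum_congr rfl fun γ _ => h _ _

lemma component_sum_E (S : Finset (Fin n → ℤ)) (f : (Fin n → ℤ) → Fin n → F) (δ : Fin n → ℤ) :
    component δ (∑ γ ∈ S, E γ (f γ)) = if δ ∈ S then f δ else 0 := by
  classical
  simp [component_E]

end

/-! ### Locally finite derivations have degree zero. -/

section

variable {F : Type*} [Field F] {n : ℕ}

/-- The derivations all of whose components of `ℓ`-degree above `d` vanish. -/
def filtration (F : Type*) [Field F] {n : ℕ} (ℓ : (Fin n → ℤ) →+ ℤ) (d : ℤ) :
    Submodule F (WittLieAlgebra F n) where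
  carrier := {x | ∀ γ, d < ℓ γ → component γ x = 0}
  add_mem' hx hy γ h := by rw [map_add, hx γ h, hy γ h, add_zero]
  zero_mem' γ _ := map_zero _
  smul_mem' c x hx γ h := by rw [map_smul, hx γ h, smul_zero]

variable {ℓ : (Fin n → ℤ) →+ ℤ}

lemma filtration_mono {a b : ℤ} (h : a ≤ b) : filtration F ℓ a ≤ filtration F ℓ b :=
  fun _ hx γ hγ => hx γ (h.trans_lt hγ)

lemma E_mem_filtration {γ : Fin n → ℤ} {d : ℤ} (h : ℓ γ ≤ d) (u : Fin n → F) :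
    E γ u ∈ filtration F ℓ d := by
  intro δ hδ
  refine component_E_of_ne ?_ u
  rintro rfl
  omega

lemma le_of_mem_support {x : WittLieAlgebra F n} {d : ℤ} (hx : x ∈ filtration F ℓ d)
    {γ : Fin n → ℤ} (hγ : γ ∈ support x) : ℓ γ ≤ d := by
  by_contra! h
  exact mem_support.1 hγ (hx γ h)

lemma lie_mem_filtration {x y : WittLieAlgebra F n} {a b : ℤ} (hx : x ∈ filtration F ℓ a)
    (hy : y ∈ filtration F ℓ b) : ⁅x, y⁆ ∈ filtration F ℓ (a + b) := by
  rw [← sum_E_component x, ← sum_E_component y,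
    sum_lie_sum (L := WittLieAlgebra F n) (M := WittLieAlgebra F n) (support x) (support y)]
  refine Submodule.sum_mem _ fun γ hγ => Submodule.sum_mem _ fun δ hδ => ?_
  rw [lie_E]
  refine E_mem_filtration ?_ _
  rw [map_add]
  exact add_le_add (le_of_mem_support hx hγ) (le_of_mem_support hy hδ)

lemma lie_sub_leading_mem {h z : WittLieAlgebra F n} {γ δ : Fin n → ℤ} {w v : Fin n → F}
    (hh : h - E γ w ∈ filtration F ℓ (ℓ γ - 1)) (hz : z - E δ v ∈ filtration F ℓ (ℓ δ - 1)) :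
    ⁅h, z⁆ - E (γ + δ) (pairing w δ • v - pairing v γ • w) ∈
      filtration F ℓ (ℓ (γ + δ) - 1) := by
  have hz' : z ∈ filtration F ℓ (ℓ δ) := by
    rw [← sub_add_cancel z (E δ v)]
    exact add_mem (filtration_mono (by omega) hz) (E_mem_filtration le_rfl v)
  have h1 := lie_mem_filtration (E_mem_filtration (F := F) (le_refl (ℓ γ)) w) hz
  have h2 := lie_mem_filtration hh hz'
  have : ⁅h, z⁆ - E (γ + δ) (pairing w δ • v - pairing v γ • w) =
      ⁅E γ w, z - E δ v⁆ + ⁅h - E γ w, z⁆ := by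
    rw [← lie_E, lie_sub (E γ w) z (E δ v), sub_lie h (E γ w) z]
    abel
  rw [this, map_add]
  exact add_mem (filtration_mono (by omega) h1) (filtration_mono (by omega) h2)

lemma exists_le_filtration (V : Submodule F (WittLieAlgebra F n)) [FiniteDimensional F V]
    (ℓ : (Fin n → ℤ) →+ ℤ) : ∃ d, V ≤ filtration F ℓ d := by
  classical
  obtain ⟨s, rfl⟩ := (Submodule.fg_top V).1 (Module.Finite.fg_top : (⊤ : Submodule F V).FG)
  obtain ⟨d, hd⟩ := ((s.biUnion support).image ℓ).bddAbove
  refine ⟨d, Submodule.span_le.2 fun x hx γ hγ => ?_⟩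
  by_contra h0
  refine absurd (hd ?_) (not_le.2 hγ)
  simp only [Finset.coe_image, Set.mem_image, Finset.mem_coe, Finset.mem_biUnion]
  exact ⟨γ, ⟨x, hx, mem_support.2 h0⟩, rfl⟩

/-- `h` acts locally finitely on the Witt algebra. -/
def AdLocallyFinite (h : WittLieAlgebra F n) : Prop :=
  ∀ y, ∃ V : Submodule F (WittLieAlgebra F n),
    FiniteDimensional F V ∧ y ∈ V ∧ ∀ z ∈ V, ⁅h, z⁆ ∈ V

/-- Each homogeneous space is an eigenspace of `ad (E 0 u)`, so the sum of those meeting `y` is a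
stable finite-dimensional space. -/
lemma adLocallyFinite_E_zero (u : Fin n → F) : AdLocallyFinite (E 0 u) := by
  intro y
  refine ⟨⨆ γ ∈ support y, LinearMap.range (E γ), ?_, ?_, ?_⟩
  · rw [iSup_subtype']
    infer_instance
  · have := sum_E_component y
    generalize support y = S at this ⊢
    rw [← this]
    refine Submodule.sum_mem _ fun γ hγ => ?_
    exact Submodule.mem_iSup_of_mem γ (Submodule.mem_iSup_of_mem hγ ⟨_, rfl⟩)
  · intro z hz
    have hle : (⨆ γ ∈ support y, LinearMap.range (E γ)) ≤
        (⨆ γ ∈ support y, LinearMap.range (E γ)).comap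
          (LieAlgebra.ad F (WittLieAlgebra F n) (E 0 u)) := by
      refine iSup₂_le fun γ hγ => ?_
      rintro _ ⟨v, rfl⟩
      refine Submodule.mem_iSup_of_mem γ (Submodule.mem_iSup_of_mem hγ ?_)
      exact ⟨pairing u γ • v - pairing v 0 • u, by simp [lie_E]⟩
    exact hle hz

lemma AdLocallyFinite.map {h : WittLieAlgebra F n} (hh : AdLocallyFinite h)
    (θ : WittLieAlgebra F n ≃ₗ⁅F⁆ WittLieAlgebra F n) : AdLocallyFinite (θ h) := by
  intro y
  obtain ⟨V, hV, hy, hstab⟩ := hh (θ.symm y)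
  refine ⟨V.map θ.toLinearEquiv.toLinearMap, inferInstance, ⟨_, hy, θ.apply_symm_apply y⟩, ?_⟩
  rintro _ ⟨z, hz, rfl⟩
  exact ⟨⁅h, z⁆, hstab z hz, LieEquiv.map_lie θ h z⟩

/-- A nonzero vector `w` and a lattice point `γ` admit `β` with `w · (β + k γ) ≠ w · γ` for all
`k : ℕ`. -/
lemma exists_forall_pairing_ne [CharZero F] {w : Fin n → F} (hw : w ≠ 0) (γ : Fin n → ℤ) :
    ∃ β : Fin n → ℤ, ∀ k : ℕ, pairing w (β + k • γ) - pairing w γ ≠ 0 := by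
  by_cases h : pairing w γ = 0
  · obtain ⟨β, hβ⟩ := exists_pairing_right_ne_zero hw
    exact ⟨β, fun k => by
      rwa [pairing_add_right, pairing_nsmul_right, h, mul_zero, add_zero, sub_zero]⟩
  -- With `β = 2γ` the difference is `(k + 1) (w · γ)`, nonzero in characteristic 0.
  · refine ⟨(2 : ℕ) • γ, fun k => ?_⟩
    rw [pairing_add_right, pairing_nsmul_right, pairing_nsmul_right,
      show ((2 : ℕ) : F) * pairing w γ + k * pairing w γ - pairing w γ =
        ((k + 1 : ℕ) : F) * pairing w γ by push_cast; ring]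
    exact mul_ne_zero (by exact_mod_cast k.succ_ne_zero) h

/-- Iterating `ad h` on `E β w` yields leading terms in degrees `β + kγ` with nonzero coefficients.
Their `ℓ`-degrees are unbounded, which is impossible inside a finite-dimensional space. -/
lemma not_adLocallyFinite_of_leading [CharZero F] {h : WittLieAlgebra F n} {γ : Fin n → ℤ}
    {w : Fin n → F} (hw : w ≠ 0) (hγ : 0 < ℓ γ) (hh : h - E γ w ∈ filtration F ℓ (ℓ γ - 1)) :
    ¬ AdLocallyFinite h := by
  intro hfin
  obtain ⟨β, hβ⟩ := exists_forall_pairing_ne hw γ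
  obtain ⟨V, hV, hy, hstab⟩ := hfin (E β w)
  obtain ⟨d, hd⟩ := exists_le_filtration V ℓ
  have key : ∀ k : ℕ, ∃ z ∈ V, ∃ c : F, c ≠ 0 ∧
      z - E (β + k • γ) (c • w) ∈ filtration F ℓ (ℓ (β + k • γ) - 1) := by
    intro k
    induction k with
    | zero => exact ⟨_, hy, 1, one_ne_zero, by simp⟩
    | succ k ih =>
      obtain ⟨z, hz, c, hc, hzc⟩ := ih
      refine ⟨_, hstab z hz, c * (pairing w (β + k • γ) - pairing w γ),
        mul_ne_zero hc (hβ k), ?_⟩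
      have := lie_sub_leading_mem hh hzc
      rw [show γ + (β + k • γ) = β + (k + 1) • γ by rw [succ_nsmul]; abel] at this
      convert this using 3
      rw [pairing_smul_left, smul_smul, ← sub_smul]
      congr 1
      ring
  obtain ⟨k, hk⟩ : ∃ k : ℕ, d < ℓ β + k * ℓ γ := by
    refine ⟨(d - ℓ β).toNat + 1, ?_⟩
    have := Int.self_le_toNat (d - ℓ β)
    push_cast
    nlinarith
  have hk' : d < ℓ (β + k • γ) := by
    rwa [map_add, map_nsmul, nsmul_eq_mul]
  obtain ⟨z, hz, c, hc, hzc⟩ := key k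
  have h1 := hzc (β + k • γ) (by omega)
  rw [map_sub, hd hz _ hk', component_E_self, zero_sub, neg_eq_zero] at h1
  exact smul_ne_zero hc hw h1

/-- Derivations acting locally finitely are homogeneous of degree zero. -/
lemma AdLocallyFinite.eq_E_zero [CharZero F] {h : WittLieAlgebra F n} (hh : AdLocallyFinite h) :
    h = E 0 (component 0 h) := by
  suffices hsupp : ∀ γ, γ ≠ 0 → component γ h = 0 by
    refine ext_component fun γ => ?_
    by_cases hγ : γ = 0
    · subst hγ; simp
    · rw [hsupp γ hγ, component_E_of_ne hγ]
  by_contra! H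
  obtain ⟨γ₀, hγ₀, hc⟩ := H
  obtain ⟨ℓ, hinj, hpos⟩ : ∃ ℓ : (Fin n → ℤ) →+ ℤ,
      Set.InjOn ℓ (support h : Set (Fin n → ℤ)) ∧ 0 < ℓ γ₀ := by
    -- Separating `0` as well makes `ℓ γ₀` nonzero; its sign can then be changed to positive.
    obtain ⟨w, hw⟩ := exists_int_injOn (insert 0 (support h))
    let ℓ : (Fin n → ℤ) →+ ℤ :=
      { toFun := fun γ => ∑ i, w i * γ i
        map_zero' := by simp
        map_add' := fun a b => by simp [mul_add, Finset.sum_add_distrib] }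
    have hℓ : Set.InjOn ℓ (insert 0 (support h) : Finset (Fin n → ℤ)) := hw
    have hne : ℓ γ₀ ≠ 0 := fun h0 => hγ₀ <| hℓ
      (Finset.mem_insert_of_mem (mem_support.2 hc)) (Finset.mem_insert_self _ _)
      (h0.trans ℓ.map_zero.symm)
    have hℓ' := hℓ.mono (Finset.coe_subset.2 (Finset.subset_insert 0 (support h)))
    rcases hne.lt_or_gt with hlt | hgt
    · exact ⟨-ℓ, fun a ha b hb hab => hℓ' ha hb (neg_injective hab), by simpa using hlt⟩
    · exact ⟨ℓ, hℓ', hgt⟩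
  obtain ⟨γ, hγ, hmax⟩ := (support h).exists_max_image ℓ ⟨γ₀, mem_support.2 hc⟩
  refine not_adLocallyFinite_of_leading (ℓ := ℓ) (mem_support.1 hγ)
    (hpos.trans_le (hmax γ₀ (mem_support.2 hc))) (fun δ hδ => ?_) hh
  by_cases hδγ : δ = γ
  · subst hδγ; simp
  · rw [map_sub, component_E_of_ne hδγ, sub_zero]
    by_contra hne
    have := hmax δ (mem_support.2 hne)
    exact hδγ (hinj (mem_support.2 hne) hγ (by omega))

end

/-! ### Rigidity of degree-preserving endomorphisms. -/

section

variable {F : Type*} [Field F] {n : ℕ}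

/-- The identity satisfied by the components of a degree-preserving endomorphism of the Witt
algebra. -/
def IsGradedEndomorphism (P : (Fin n → ℤ) → (Fin n → F) →ₗ[F] (Fin n → F)) : Prop :=
  ∀ α β u v, P (α + β) (pairing u β • v - pairing v α • u) =
    pairing (P α u) β • P β v - pairing (P β v) α • P α u

variable {P : (Fin n → ℤ) → (Fin n → F) →ₗ[F] (Fin n → F)}

lemma IsGradedEndomorphism.exists_apply_eq [CharZero F] (hP : IsGradedEndomorphism P)
    (h0 : P 0 = LinearMap.id) {α : Fin n → ℤ} (hα : α ≠ 0) :
    ∃ (c : F) (k : Fin n → F), c ≠ 0 ∧ pairing k α = 0 ∧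
      ∀ u, P α u = c • (u + pairing u α • k) := by
  -- The bracket of degrees `α` and `-α` lands in degree 0, where `P` is the identity.
  have hR : ∀ u v, pairing u α • v + pairing v α • u =
      pairing (P α u) α • P (-α) v + pairing (P (-α) v) α • P α u := by
    intro u v
    have := hP α (-α) u v
    rw [add_neg_cancel, h0, LinearMap.id_apply, pairing_neg_right, pairing_neg_right] at this
    calc pairing u α • v + pairing v α • u = -(-pairing u α • v - pairing v α • u) := by module
      _ = _ := by rw [this]; module
  have ha : ∀ u v, pairing u α * pairing v α = pairing (P α u) α * pairing (P (-α) v) α := by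
    intro u v
    have := congrArg (pairing · α) (hR u v)
    simp only [pairing_add_left, pairing_smul_left] at this
    refine mul_left_cancel₀ (two_ne_zero (α := F)) ?_
    linear_combination this
  obtain ⟨v₁, hv₁⟩ := exists_pairing_ne_zero (F := F) hα
  obtain ⟨v, hv⟩ : ∃ v : Fin n → F, pairing v α = 1 :=
    ⟨(pairing v₁ α)⁻¹ • v₁, by rw [pairing_smul_left, inv_mul_cancel₀ hv₁]⟩
  set c := pairing (P α v) α with hc
  set d := pairing (P (-α) v) α with hd
  have hcd : c * d = 1 := by rw [hc, hd, ← ha, hv, one_mul]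
  have hau : ∀ u, pairing (P α u) α = c * pairing u α := by
    intro u
    have := ha u v
    rw [hv, ← hd] at this
    linear_combination (-c) * this - pairing (P α u) α * hcd
  refine ⟨c, v - c • P (-α) v, left_ne_zero_of_mul_eq_one hcd, ?_, fun u => ?_⟩
  · rw [pairing_sub_left, pairing_smul_left, hv, ← hd, hcd, sub_self]
  · have := congrArg (c • ·) (hR u v)
    simp only [hv, hau, ← hd, smul_add, smul_smul, hcd, one_smul] at this
    rw [smul_add, smul_smul, smul_sub, smul_smul, eq_comm, ← sub_eq_zero]
    rw [← sub_eq_zero] at this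
    rw [← this]
    module

/-- Here `E α u` and `E β v` commute. Pairing the image relation with `α` and with `β`, and setting
`x = k · β`, `y = l · α`, gives `xy = y` and `x = yx`. Hence `x² = x`. -/
lemma IsGradedEndomorphism.pairing_eq_zero_or_one (hP : IsGradedEndomorphism P)
    {α β : Fin n → ℤ} {c d : F} {k l u v : Fin n → F} (hc : c ≠ 0) (hd : d ≠ 0)
    (hkα : pairing k α = 0) (hlβ : pairing l β = 0)
    (hα : ∀ u, P α u = c • (u + pairing u α • k)) (hβ : ∀ u, P β u = d • (u + pairing u β • l))
    (huα : pairing u α = 1) (huβ : pairing u β = 0) (hvα : pairing v α = 0)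
    (hvβ : pairing v β = 1) : pairing k β = 0 ∨ pairing k β = 1 := by
  have h := hP α β u v
  rw [huβ, hvα, zero_smul, zero_smul, sub_self, map_zero, hα, hβ, huα, hvβ, one_smul,
    one_smul] at h
  have h1 := congrArg (pairing · α) h
  have h2 := congrArg (pairing · β) h
  simp only [pairing_sub_left, pairing_smul_left, pairing_add_left, pairing_zero_left, huα, huβ,
    hvα, hvβ, hkα, hlβ] at h1 h2
  have hcd := mul_ne_zero hc hd
  have h3 : pairing k β * pairing l α = pairing l α :=
    mul_left_cancel₀ hcd (by linear_combination -h1)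
  have h4 : pairing k β = pairing l α * pairing k β :=
    mul_left_cancel₀ hcd (by linear_combination -h2)
  have h5 : pairing k β * (pairing k β - 1) = 0 := by
    linear_combination pairing k β * (h4 + h3) - h4
  rcases mul_eq_zero.1 h5 with h | h
  · exact Or.inl h
  · exact Or.inr (sub_eq_zero.1 h)

lemma IsGradedEndomorphism.exists_eq_smul [CharZero F] (hP : IsGradedEndomorphism P)
    (h0 : P 0 = LinearMap.id) (α : Fin n → ℤ) :
    ∃ c : F, c ≠ 0 ∧ (∀ u, P α u = c • u) ∧ (α = 0 → c = 1) := by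
  by_cases hα : α = 0
  · subst hα
    exact ⟨1, one_ne_zero, fun u => by rw [h0, one_smul, LinearMap.id_apply], fun _ => rfl⟩
  obtain ⟨c, k, hc, hk, hPα⟩ := hP.exists_apply_eq h0 hα
  refine ⟨c, hc, fun u => ?_, fun h => absurd h hα⟩
  suffices hk0 : k = 0 by rw [hPα, hk0, smul_zero, add_zero]
  by_contra hk0
  obtain ⟨β, hβ⟩ := exists_pairing_right_ne_zero hk0
  obtain ⟨w, hw⟩ := exists_pairing_ne_zero (F := F) hα
  obtain ⟨v, hvα, hvβ⟩ : ∃ v : Fin n → F, pairing v α = 0 ∧ pairing v β = 1 :=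
    ⟨(pairing k β)⁻¹ • k, by simp [hk], by simp [hβ]⟩
  obtain ⟨u, huα, huβ⟩ : ∃ u : Fin n → F, pairing u α = 1 ∧ pairing u β = 0 :=
    ⟨(pairing w α)⁻¹ • w - ((pairing w α)⁻¹ * pairing w β) • v, by simp [hvα, hw],
      by simp [hvβ]⟩
  have hβ0 : β ≠ 0 := by rintro rfl; simp at hβ
  -- The dichotomy is applied to `β` and to `2β`: `k · β = 1` would force `2` to be `0` or `1`.
  have h2β : pairing ((2 : F)⁻¹ • v) (β + β) = 1 := by
    rw [pairing_smul_left, pairing_add_right, hvβ, one_add_one_eq_two, inv_mul_cancel₀ two_ne_zero]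
  have h2β0 : β + β ≠ 0 := by
    intro h
    rw [h, pairing_zero_right] at h2β
    exact zero_ne_one h2β
  obtain ⟨d, l, hd, hl, hPβ⟩ := hP.exists_apply_eq h0 hβ0
  obtain ⟨d', l', hd', hl', hPβ'⟩ := hP.exists_apply_eq h0 h2β0
  have h1 := hP.pairing_eq_zero_or_one hc hd hk hl hPα hPβ huα huβ hvα hvβ
  have h2 := hP.pairing_eq_zero_or_one hc hd' hk hl' hPα hPβ' huα
    (by rw [pairing_add_right, huβ, add_zero]) (by rw [pairing_smul_left, hvα, mul_zero]) h2β
  have h1' := h1.resolve_left hβ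
  rw [pairing_add_right, h1'] at h2
  rcases h2 with h | h
  · exact two_ne_zero (one_add_one_eq_two (R := F) ▸ h)
  · exact one_ne_zero (add_eq_left.1 h)

/-- A degree-preserving endomorphism of the Witt algebra fixing the degree-zero part acts by a
character of the lattice. -/
lemma IsGradedEndomorphism.exists_character [CharZero F] (hP : IsGradedEndomorphism P)
    (h0 : P 0 = LinearMap.id) :
    ∃ c : (Fin n → ℤ) → F, (∀ α u, P α u = c α • u) ∧ (∀ α, c α ≠ 0) ∧ c 0 = 1 ∧
      ∀ α β, c (α + β) = c α * c β := by
  choose c hc hPc hc0 using hP.exists_eq_smul h0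
  have hne : ∀ α β, α ≠ β → c (α + β) = c α * c β := by
    intro α β hαβ
    obtain ⟨u, hu⟩ := exists_pairing_ne_zero (F := F) (sub_ne_zero.2 hαβ.symm)
    have hu0 : u ≠ 0 := by rintro rfl; simp at hu
    rw [pairing_sub_right] at hu
    have := hP α β u u
    simp only [hPc, pairing_smul_left, ← sub_smul, smul_smul] at this
    have := smul_left_injective F hu0 this
    refine mul_right_cancel₀ hu ?_
    linear_combination this
  refine ⟨c, hPc, hc, hc0 0 rfl, fun α β => ?_⟩
  rcases eq_or_ne α β with rfl | h
  · by_cases hα : α = 0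
    · rw [hα, add_zero, hc0 0 rfl, one_mul]
    -- Multiplicativity is known only at distinct arguments, so `c(2α)` is computed as `c(4α)
    -- c(-2α)`, with `c(4α)` built up through `3α`.
    have ne_of : ∀ {γ δ : Fin n → ℤ} (m : ℕ), m ≠ 0 → γ = δ + m • α → γ ≠ δ :=
      fun m hm h h' => smul_ne_zero hm hα (add_eq_left.1 (h.symm.trans h'))
    have e1 := hne (α + α) α (ne_of 1 (by simp) (by abel))
    have e2 := hne (α + α + α) α (ne_of 2 (by simp) (by abel))
    have e3 := hne (α + α + α + α) (-(α + α)) (ne_of 6 (by simp) (by abel))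
    have e4 := hne (α + α) (-(α + α)) (ne_of 4 (by simp) (by abel))
    rw [add_neg_cancel, hc0 0 rfl] at e4
    rw [show α + α + α + α + -(α + α) = α + α by abel, e2, e1] at e3
    have := hc (α + α)
    refine mul_left_cancel₀ this ?_
    linear_combination c (α + α) * e3 + c (α + α) * c α * c α * (-1) * e4 
  · exact hne α β h

end

/-! ### Normal form of automorphisms. -/

section

variable {F : Type*} [Field F] {n : ℕ}

lemma component_lie_E_zero (a : Fin n → F) (y : WittLieAlgebra F n) (δ : Fin n → ℤ) :
    component δ ⁅E 0 a, y⁆ = pairing a δ • component δ y := by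
  have : component δ ∘ₗ LieAlgebra.ad F (WittLieAlgebra F n) (E 0 a) =
      pairing a δ • component δ := by
    refine linear_ext fun α u => ?_
    simp only [LinearMap.comp_apply, LieAlgebra.ad_apply, lie_E, LinearMap.smul_apply,
      pairing_zero_right, zero_smul, sub_zero, zero_add, component_E]
    split_ifs with h
    · rw [h]
    · rw [smul_zero]
  exact LinearMap.congr_fun this y

variable [CharZero F]

lemma map_E_zero (θ : WittLieAlgebra F n ≃ₗ⁅F⁆ WittLieAlgebra F n) (u : Fin n → F) :
    θ (E 0 u) = E 0 (component 0 (θ (E 0 u))) :=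
  ((adLocallyFinite_E_zero u).map θ).eq_E_zero

/-- The action of an automorphism on the degree-zero part. -/
noncomputable def cartanEquiv (θ : WittLieAlgebra F n ≃ₗ⁅F⁆ WittLieAlgebra F n) :
    (Fin n → F) ≃ₗ[F] (Fin n → F) :=
  LinearEquiv.ofLinearMap
    (component 0 ∘ₗ θ.toLinearEquiv.toLinearMap ∘ₗ E 0)
    (component 0 ∘ₗ θ.symm.toLinearEquiv.toLinearMap ∘ₗ E 0)
    (LinearMap.ext fun u => by
      change component 0 (θ (E 0 (component 0 (θ.symm (E 0 u))))) = u
      rw [← map_E_zero, LieEquiv.apply_symm_apply, component_E_self])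
    (LinearMap.ext fun u => by
      change component 0 (θ.symm (E 0 (component 0 (θ (E 0 u))))) = u
      rw [← map_E_zero, LieEquiv.symm_apply_apply, component_E_self])

lemma map_E_zero_eq (θ : WittLieAlgebra F n ≃ₗ⁅F⁆ WittLieAlgebra F n) (u : Fin n → F) :
    θ (E 0 u) = E 0 (cartanEquiv θ u) :=
  map_E_zero θ u

/-- Compares the `δ`-components of both sides of `θ ⁅E 0 w, E α u⁆ = ⁅θ (E 0 w), θ (E α u)⁆`; a
nonzero component forces its weight to match that of `α`. -/
lemma pairing_smul_component_map (θ : WittLieAlgebra F n ≃ₗ⁅F⁆ WittLieAlgebra F n)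
    (α δ : Fin n → ℤ) (u w : Fin n → F) :
    pairing (cartanEquiv θ w) δ • component δ (θ (E α u)) =
      pairing w α • component δ (θ (E α u)) := by
  rw [← component_lie_E_zero, ← map_E_zero_eq, ← LieEquiv.map_lie, lie_E]
  simp

lemma exists_weight (θ : WittLieAlgebra F n ≃ₗ⁅F⁆ WittLieAlgebra F n) (α : Fin n → ℤ) :
    ∃ δ : Fin n → ℤ, ∀ w, pairing (cartanEquiv θ w) δ = pairing w α := by
  rcases isEmpty_or_nonempty (Fin n) with hn | hn
  -- For `n = 0` there is no nonzero vector to supply a weight, but all pairings vanish.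
  · exact ⟨α, fun w => by simp [pairing]⟩
  obtain ⟨δ, hδ⟩ : ∃ δ, component δ (θ (E α fun _ => 1)) ≠ 0 := by
    by_contra! H
    have h0 : θ (E α fun _ => 1) = 0 := ext_component fun γ => by rw [H, map_zero]
    have : (fun _ : Fin n => (1 : F)) = 0 :=
      E_eq_zero_iff.1 (θ.injective (h0.trans (map_zero _).symm))
    exact one_ne_zero (congrFun this (Classical.arbitrary (Fin n)))
  exact ⟨δ, fun w => smul_left_injective F hδ (pairing_smul_component_map θ α δ _ w)⟩

lemma eq_of_pairing_cartanEquiv (θ : WittLieAlgebra F n ≃ₗ⁅F⁆ WittLieAlgebra F n)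
    {α β : Fin n → ℤ} (h : ∀ w, pairing (cartanEquiv θ w) α = pairing (cartanEquiv θ w) β) :
    α = β :=
  eq_of_forall_pairing_eq (F := F) fun u => by
    simpa using h ((cartanEquiv θ).symm u)

/-- An expression of `θ` in the form `t^α D_u ↦ χ(α) t^{Mα} D_{Au}`, where `χ` is a character of
the lattice and `A`, `M` are contragredient to each other. -/
structure NormalForm (θ : WittLieAlgebra F n ≃ₗ⁅F⁆ WittLieAlgebra F n) where
  /-- The action on the degree-zero part. -/
  A : (Fin n → F) ≃ₗ[F] (Fin n → F)
  /-- The action on degrees. -/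
  M : (Fin n → ℤ) → Fin n → ℤ
  /-- The character. -/
  χ : (Fin n → ℤ) → F
  pairing_eq : ∀ u α, pairing (A u) (M α) = pairing u α
  map_E : ∀ α u, θ (E α u) = E (M α) (χ α • A u)
  χ_ne_zero : ∀ α, χ α ≠ 0
  χ_zero : χ 0 = 1
  M_zero : M 0 = 0
  χ_add : ∀ α β, χ (α + β) = χ α * χ β

/-- Every automorphism of the Witt algebra has a normal form. -/
theorem nonempty_normalForm (θ : WittLieAlgebra F n ≃ₗ⁅F⁆ WittLieAlgebra F n) :
    Nonempty (NormalForm θ) := by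
  set A := cartanEquiv θ with hA
  choose M hM using exists_weight θ
  have hM0 : M 0 = 0 := eq_of_pairing_cartanEquiv θ fun w => by simp [hM]
  have hMadd : ∀ α β, M (α + β) = M α + M β := fun α β =>
    eq_of_pairing_cartanEquiv θ fun w => by simp [hM]
  let P : (Fin n → ℤ) → (Fin n → F) →ₗ[F] (Fin n → F) := fun α =>
    A.symm.toLinearMap ∘ₗ component (M α) ∘ₗ θ.toLinearEquiv.toLinearMap ∘ₗ E α
  have hAP : ∀ α u, A (P α u) = component (M α) (θ (E α u)) := fun α u =>
    A.apply_symm_apply _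
  have hθ : ∀ α u, θ (E α u) = E (M α) (A (P α u)) := by
    intro α u
    refine ext_component fun δ => ?_
    by_cases hδ : δ = M α
    · rw [hδ, component_E_self, hAP]
    · rw [component_E_of_ne hδ]
      by_contra hne
      refine hδ (eq_of_pairing_cartanEquiv θ fun w => ?_)
      rw [hM]
      exact smul_left_injective F hne (pairing_smul_component_map θ α δ u w)
  have hP0 : P 0 = LinearMap.id := LinearMap.ext fun u => A.injective <| E_injective (M 0) <| by
    rw [← hθ, hM0, map_E_zero_eq]; rfl
  have hP : IsGradedEndomorphism P := by
    intro α β u v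
    apply A.injective
    apply E_injective (M (α + β))
    rw [← hθ, ← lie_E, LieEquiv.map_lie, hθ, hθ, lie_E, hM, hM, hMadd, map_sub A, map_smul A,
      map_smul A]
  obtain ⟨c, hc, hc0, hc1, hcadd⟩ := hP.exists_character hP0
  exact ⟨⟨A, M, c, fun u α => hM α u, fun α u => by rw [hθ, hc, map_smul], hc0, hc1, hM0,
    hcadd⟩⟩

end

/-! ### An element with trivial stabilizer; 2-local automorphisms. -/

section

variable {F : Type*} [Field F] {n : ℕ}

/-- The origin and the unit vectors. -/
noncomputable def simplexPoints (n : ℕ) : Finset (Fin n → ℤ) := by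
  classical exact insert 0 (Finset.univ.image fun i => Pi.single i 1)

lemma zero_mem_simplexPoints : (0 : Fin n → ℤ) ∈ simplexPoints n := by
  simp [simplexPoints]

lemma single_mem_simplexPoints (i : Fin n) : Pi.single i 1 ∈ simplexPoints n := by
  simp [simplexPoints]

lemma sum_simplexPoints {V : Type*} [AddCommMonoid V] (f : (Fin n → ℤ) → V) :
    ∑ γ ∈ simplexPoints n, f γ = f 0 + ∑ i, f (Pi.single i 1) := by
  classical
  rw [simplexPoints, Finset.sum_insert, Finset.sum_image]
  · intro i _ j _ hij
    by_contra hne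
    simpa [hne] using congrFun hij i
  · simp

lemma ne_zero_of_injOn (hn : 1 ≤ n) {S : Finset (Fin n → ℤ)} (hS : simplexPoints n ⊆ S)
    {w : Fin n → F} (hinj : Set.InjOn (pairing w) (S : Set (Fin n → ℤ))) : w ≠ 0 := by
  rintro rfl
  have := hinj (hS zero_mem_simplexPoints) (hS (single_mem_simplexPoints ⟨0, hn⟩)) (by simp)
  simpa using congrFun this ⟨0, hn⟩

lemma NormalForm.map_E_zero {θ : WittLieAlgebra F n ≃ₗ⁅F⁆ WittLieAlgebra F n}
    (N : NormalForm θ) (u : Fin n → F) : θ (E 0 u) = E 0 (N.A u) := by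
  rw [N.map_E, N.M_zero, N.χ_zero, one_smul]

variable [CharZero F]

namespace NormalForm

variable {θ : WittLieAlgebra F n ≃ₗ⁅F⁆ WittLieAlgebra F n} (N : NormalForm θ)

lemma M_injective : Function.Injective N.M := fun α β h =>
  eq_of_forall_pairing_eq (F := F) fun u => by rw [← N.pairing_eq, h, N.pairing_eq]

lemma M_ne_zero {α : Fin n → ℤ} (h : α ≠ 0) : N.M α ≠ 0 := fun h0 =>
  h (N.M_injective (h0.trans N.M_zero.symm))

/-- An automorphism whose normal form is trivial on the unit vectors is the identity. -/
lemma apply_eq_self (hM : ∀ i, N.M (Pi.single i 1) = Pi.single i 1)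
    (hχ : ∀ i, N.χ (Pi.single i 1) = 1) (x : WittLieAlgebra F n) : θ x = x := by
  have hA : ∀ u, N.A u = u := by
    intro u
    ext i
    have := N.pairing_eq u (Pi.single i 1)
    rwa [hM, pairing_single_right, pairing_single_right] at this
  have hM' : ∀ α, N.M α = α := fun α =>
    eq_of_forall_pairing_eq (F := F) fun u => by
      have := N.pairing_eq u α
      rwa [hA] at this
  have hχ' : ∀ α, N.χ α = 1 := by
    refine lattice_induction hχ N.χ_zero (fun α β hα hβ => ?_) fun α hα => ?_
    · rw [N.χ_add, hα, hβ, one_mul]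
    · have := N.χ_add α (-α)
      rwa [add_neg_cancel, N.χ_zero, hα, one_mul, eq_comm] at this
  have : θ.toLinearEquiv.toLinearMap = LinearMap.id :=
    linear_ext fun α u => by
      change θ (E α u) = E α u
      rw [N.map_E, hM', hχ', hA, one_smul]
  exact LinearMap.congr_fun this x

/-- If `w` separates the points of `S`, an automorphism mapping `∑ t^γ D_w` to
`∑ g(γ) t^γ D_w` with `g(0) = 1` fixes the points of `S` and has character `g` on `S`. -/
lemma of_map_sum_E {S : Finset (Fin n → ℤ)} {w : Fin n → F} {g : (Fin n → ℤ) → F}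
    (hS : 0 ∈ S) (hw : w ≠ 0) (hinj : Set.InjOn (pairing w) (S : Set (Fin n → ℤ))) (hg : g 0 = 1)
    (h : θ (∑ γ ∈ S, E γ w) = ∑ γ ∈ S, E γ (g γ • w)) :
    ∀ γ ∈ S, N.M γ = γ ∧ N.χ γ = g γ := by
  have hcomp : ∀ γ ∈ S, N.χ γ • N.A w = if N.M γ ∈ S then g (N.M γ) • w else 0 := by
    intro γ hγ
    rw [← component_sum_E S (fun γ => g γ • w), ← h, map_sum, map_sum, Finset.sum_eq_single γ]
    · rw [N.map_E, component_E_self]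
    · intro δ _ hδ
      rw [N.map_E, component_E_of_ne (N.M_injective.ne hδ.symm)]
    · exact fun hγ' => absurd hγ hγ'
  -- Degree 0 is the one degree known in advance to be kept, with character value 1.
  have hA : N.A w = w := by
    have := hcomp 0 hS
    rwa [N.M_zero, N.χ_zero, if_pos hS, hg, one_smul, one_smul] at this
  intro γ hγ
  have hγ' := hcomp γ hγ
  rw [hA] at hγ'
  have hmem : N.M γ ∈ S := by
    by_contra hmem
    rw [if_neg hmem] at hγ'
    exact smul_ne_zero (N.χ_ne_zero γ) hw hγ'
  have hMγ : N.M γ = γ := hinj hmem hγ (by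
    have := N.pairing_eq w γ
    rwa [hA] at this)
  rw [if_pos hmem, hMγ] at hγ'
  exact ⟨hMγ, smul_left_injective F hw hγ'⟩

end NormalForm

/-- An automorphism fixing `∑ t^γ D_w`, where `w` separates the points of `S` and `S` contains the
origin and the unit vectors, is the identity. -/
lemma eq_self_of_map_sum_E (hn : 1 ≤ n) {S : Finset (Fin n → ℤ)} (hS : simplexPoints n ⊆ S)
    {w : Fin n → F} (hinj : Set.InjOn (pairing w) (S : Set (Fin n → ℤ)))
    {g : (Fin n → ℤ) → F} (hg0 : g 0 = 1) (hg : ∀ i, g (Pi.single i 1) = 1)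
    {θ : WittLieAlgebra F n ≃ₗ⁅F⁆ WittLieAlgebra F n}
    (h : θ (∑ γ ∈ S, E γ w) = ∑ γ ∈ S, E γ (g γ • w)) (x : WittLieAlgebra F n) : θ x = x := by
  obtain ⟨N⟩ := nonempty_normalForm θ
  have key := N.of_map_sum_E (hS zero_mem_simplexPoints) (ne_zero_of_injOn hn hS hinj) hinj hg0 h
  refine N.apply_eq_self (fun i => (key _ (hS (single_mem_simplexPoints i))).1) (fun i => ?_) x
  rw [(key _ (hS (single_mem_simplexPoints i))).2, hg]

/-- Some element of the Witt algebra is fixed by no automorphism except the identity. -/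
lemma exists_trivial_stabilizer (hn : 1 ≤ n) :
    ∃ w : Fin n → F, Set.InjOn (pairing w) (simplexPoints n : Set (Fin n → ℤ)) ∧
      ∀ θ : WittLieAlgebra F n ≃ₗ⁅F⁆ WittLieAlgebra F n,
        θ (∑ γ ∈ simplexPoints n, E γ w) = ∑ γ ∈ simplexPoints n, E γ w → ∀ x, θ x = x := by
  obtain ⟨w, hw⟩ := exists_pairing_injOn (F := F) (simplexPoints n)
  exact ⟨w, hw, fun θ h => eq_self_of_map_sum_E hn subset_rfl hw (g := fun _ => 1) rfl
    (fun _ => rfl) (by simpa using h)⟩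

theorem isLieAutomorphism_of_isTwoLocal (hn : 1 ≤ n)
    {Φ : WittLieAlgebra F n → WittLieAlgebra F n} (hΦ : IsTwoLocalAutomorphism F Φ) :
    IsLieAutomorphism F Φ := by
  obtain ⟨w, -, hstab⟩ := exists_trivial_stabilizer (F := F) hn
  obtain ⟨θ₀, h₀, -⟩ := hΦ (∑ γ ∈ simplexPoints n, E γ w) 0
  refine ⟨θ₀, fun y => ?_⟩
  obtain ⟨θ, h₁, h₂⟩ := hΦ (∑ γ ∈ simplexPoints n, E γ w) y
  have := hstab (θ.trans θ₀.symm) (by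
    rw [LieEquiv.trans_apply, ← h₁, h₀, LieEquiv.symm_apply_apply]) y
  rw [LieEquiv.trans_apply, ← h₂] at this
  rw [← θ₀.apply_symm_apply (Φ y), this]

/-! ### Local automorphisms. -/

section Local

variable {Ψ : WittLieAlgebra F n →ₗ[F] WittLieAlgebra F n}

lemma local_map_E_zero (hΨ : ∀ x, ∃ θ : WittLieAlgebra F n ≃ₗ⁅F⁆ WittLieAlgebra F n, Ψ x = θ x)
    (u : Fin n → F) : Ψ (E 0 u) = E 0 (component 0 (Ψ (E 0 u))) := by
  obtain ⟨θ, h⟩ := hΨ (E 0 u)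
  rw [h, ← WittLieAlgebra.map_E_zero]

/-- Evaluating at `E 0 u + E α v` makes one automorphism govern both summands, since linearity and
degrees split the value. The element `Ψ (E α v)` does not involve `u`, so neither does its degree
`β`. -/
lemma local_map_E (hΨ : ∀ x, ∃ θ : WittLieAlgebra F n ≃ₗ⁅F⁆ WittLieAlgebra F n, Ψ x = θ x)
    {α : Fin n → ℤ} (hα : α ≠ 0) {v : Fin n → F} (hv : v ≠ 0) :
    ∃ (β : Fin n → ℤ) (c : F), β ≠ 0 ∧ c ≠ 0 ∧ Ψ (E α v) = E β (c • component 0 (Ψ (E 0 v))) ∧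
      ∀ u, pairing (component 0 (Ψ (E 0 u))) β = pairing u α := by
  have key : ∀ u, ∃ (β : Fin n → ℤ) (c : F) (a : Fin n → F), β ≠ 0 ∧ c ≠ 0 ∧ a ≠ 0 ∧
      Ψ (E α v) = E β (c • a) ∧ pairing (component 0 (Ψ (E 0 u))) β = pairing u α ∧
      (u = v → a = component 0 (Ψ (E 0 v))) := by
    intro u
    obtain ⟨θ₁, h₁⟩ := hΨ (E α v)
    obtain ⟨N₁⟩ := nonempty_normalForm θ₁
    obtain ⟨θ, h⟩ := hΨ (E 0 u + E α v)
    obtain ⟨N⟩ := nonempty_normalForm θ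
    rw [map_add, map_add, N.map_E_zero, N.map_E] at h
    have h0 := congrArg (component 0) h
    rw [map_add, map_add, h₁, N₁.map_E, component_E_of_ne (N₁.M_ne_zero hα).symm,
      component_E_of_ne (N.M_ne_zero hα).symm, component_E_self, add_zero, add_zero] at h0
    rw [local_map_E_zero hΨ, h0, add_right_inj] at h
    refine ⟨N.M α, N.χ α, N.A v, N.M_ne_zero hα, N.χ_ne_zero α,
      (map_ne_zero_iff _ N.A.injective).2 hv, h, ?_, ?_⟩
    · rw [h0, N.pairing_eq]
    · rintro rfl
      exact h0.symm
  obtain ⟨β, c, a, hβ, hc, ha, h, -, hav⟩ := key v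
  refine ⟨β, c, hβ, hc, hav rfl ▸ h, fun u => ?_⟩
  obtain ⟨β', c', a', -, -, -, h', hp, -⟩ := key u
  rwa [eq_of_E_eq (h.symm.trans h') (smul_ne_zero hc ha)]

/-- A local automorphism fixing `∑ t^γ D_w`, with `w` separating the origin and the unit vectors,
fixes the degree-zero part and each `tᵢ D_w`. -/
lemma local_fixes (hn : 1 ≤ n)
    (hΨ : ∀ x, ∃ θ : WittLieAlgebra F n ≃ₗ⁅F⁆ WittLieAlgebra F n, Ψ x = θ x) {w : Fin n → F}
    (hinj : Set.InjOn (pairing w) (simplexPoints n : Set (Fin n → ℤ)))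
    (hfix : Ψ (∑ γ ∈ simplexPoints n, E γ w) = ∑ γ ∈ simplexPoints n, E γ w) :
    (∀ u, Ψ (E 0 u) = E 0 u) ∧ ∀ i, Ψ (E (Pi.single i 1) w) = E (Pi.single i 1) w := by
  have hw := ne_zero_of_injOn hn subset_rfl hinj
  have hsingle : ∀ i : Fin n, (Pi.single i 1 : Fin n → ℤ) ≠ 0 := fun i => by simp
  have hlocal := fun i => local_map_E hΨ (hsingle i) hw
  choose β c hβ hc hΨβ hpair using hlocal
  set B : (Fin n → F) → (Fin n → F) := fun u => component 0 (Ψ (E 0 u)) with hB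
  have hsum : E 0 (B w) + ∑ i, E (β i) (c i • B w) = ∑ γ ∈ simplexPoints n, E γ w := by
    rw [← hfix, sum_simplexPoints, map_add, map_sum, local_map_E_zero hΨ]
    exact congrArg _ (Finset.sum_congr rfl fun i _ => (hΨβ i).symm)
  have hw0 : B w = w := by
    have := congrArg (component 0) hsum
    rw [component_sum_E, if_pos zero_mem_simplexPoints, map_add, component_E_self, map_sum,
      Finset.sum_eq_zero fun i _ => component_E_of_ne (hβ i).symm _, add_zero] at this
    exact this
  have hβw : ∀ i, pairing w (β i) = pairing w (Pi.single i 1) := fun i => by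
    have : pairing (B w) (β i) = pairing w (Pi.single i 1) := hpair i w
    rwa [hw0] at this
  -- The `β i` are nonzero, and pairwise distinct because `w` takes different values on them.
  have hcomp : ∀ i, component (β i) (∑ γ ∈ simplexPoints n, E γ w) = c i • w := by
    intro i
    rw [← hsum, hw0, map_add, component_E_of_ne (hβ i), zero_add, map_sum,
      Finset.sum_eq_single i, component_E_self]
    · intro j _ hji
      refine component_E_of_ne (fun h => hji ?_) _
      have := hinj (single_mem_simplexPoints i) (single_mem_simplexPoints j)
        (by rw [← hβw, ← hβw, h])
      by_contra hne
      simpa [hne] using congrFun this j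
    · simp
  have hβi : ∀ i, β i = Pi.single i 1 := by
    intro i
    refine hinj (Finset.mem_coe.2 ?_) (single_mem_simplexPoints i) (hβw i)
    by_contra hmem
    have := hcomp i
    rw [component_sum_E, if_neg hmem] at this
    exact smul_ne_zero (hc i) hw this.symm
  constructor
  · intro u
    rw [local_map_E_zero hΨ]
    congr 1
    ext i
    have := hpair i u
    rwa [hβi, pairing_single_right, pairing_single_right] at this
  · intro i
    have := hcomp i
    rw [hβi, component_sum_E, if_pos (single_mem_simplexPoints i)] at this
    rw [hΨβ, hβi]
    exact congrArg _ ((congrArg (c i • ·) hw0).trans this.symm)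

/-- A local automorphism that fixes the degree-zero part acts on each homogeneous component as a
scalar. -/
lemma exists_local_map_E_eq_smul
    (hΨ : ∀ x, ∃ θ : WittLieAlgebra F n ≃ₗ⁅F⁆ WittLieAlgebra F n, Ψ x = θ x)
    (h0 : ∀ u, Ψ (E 0 u) = E 0 u) (α : Fin n → ℤ) :
    ∃ c : F, ∀ v, Ψ (E α v) = E α (c • v) := by
  by_cases hα : α = 0
  · subst hα
    exact ⟨1, fun v => by rw [h0, one_smul]⟩
  have key : ∀ v, ∃ c : F, Ψ (E α v) = E α (c • v) := by
    intro v
    by_cases hv : v = 0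
    · exact ⟨0, by simp [hv]⟩
    obtain ⟨β, c, -, -, h, hp⟩ := local_map_E hΨ hα hv
    simp only [h0, component_E_self] at h hp
    exact ⟨c, by rw [h, eq_of_forall_pairing_eq hp]⟩
  -- A linear map for which every nonzero vector is an eigenvector is a scalar.
  obtain ⟨c, hc⟩ := LinearMap.exists_eq_smul_id_of_forall_notLinearIndependent
    (f := component α ∘ₗ Ψ ∘ₗ E α) fun v => by
      obtain ⟨c, hc⟩ := key v
      intro hli
      have := LinearIndependent.pair_iff.1 hli c (-1) (by simp [hc])
      simp at this
  refine ⟨c, fun v => ?_⟩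
  obtain ⟨d, hd⟩ := key v
  have := LinearMap.congr_fun hc v
  simp only [LinearMap.comp_apply, hd, component_E_self] at this
  rw [hd, this]
  rfl

/-- A local automorphism fixing `∑ t^γ D_w`, with `w` separating the origin and the unit vectors,
is the identity. -/
lemma local_eq_id (hn : 1 ≤ n)
    (hΨ : ∀ x, ∃ θ : WittLieAlgebra F n ≃ₗ⁅F⁆ WittLieAlgebra F n, Ψ x = θ x) {w : Fin n → F}
    (hinj : Set.InjOn (pairing w) (simplexPoints n : Set (Fin n → ℤ)))
    (hfix : Ψ (∑ γ ∈ simplexPoints n, E γ w) = ∑ γ ∈ simplexPoints n, E γ w) :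
    Ψ = LinearMap.id := by
  classical
  obtain ⟨h0, h1⟩ := local_fixes hn hΨ hinj hfix
  choose χ hχ using exists_local_map_E_eq_smul hΨ h0
  have eq_one : ∀ {α : Fin n → ℤ} {v : Fin n → F}, v ≠ 0 → Ψ (E α v) = E α v → χ α = 1 := by
    intro α v hv h
    rw [hχ] at h
    exact smul_left_injective F hv ((E_injective α h).trans (one_smul F v).symm)
  have hw := ne_zero_of_injOn hn subset_rfl hinj
  refine linear_ext fun α v => ?_
  obtain ⟨w', hw'⟩ := exists_pairing_injOn (F := F) (insert α (simplexPoints n))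
  have hS := Finset.subset_insert α (simplexPoints n)
  -- This `θ` has trivial character on the unit vectors, hence is the identity; comparing degree `α`
  -- gives `χ α = 1`.
  obtain ⟨θ, hθ⟩ := hΨ (∑ γ ∈ insert α (simplexPoints n), E γ w')
  have hsum : Ψ (∑ γ ∈ insert α (simplexPoints n), E γ w') =
      ∑ γ ∈ insert α (simplexPoints n), E γ (χ γ • w') := by
    rw [map_sum]
    exact Finset.sum_congr rfl fun γ _ => hχ γ w'
  have hid := eq_self_of_map_sum_E hn hS hw' (eq_one hw (h0 w)) (fun i => eq_one hw (h1 i))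
    (hθ.symm.trans hsum)
  rw [hθ, hid] at hsum
  have hα := congrArg (component α) hsum
  rw [component_sum_E, component_sum_E _ (fun γ => χ γ • w'),
    if_pos (Finset.mem_insert_self α _), if_pos (Finset.mem_insert_self α _)] at hα
  have hw'0 := ne_zero_of_injOn hn hS hw'
  rw [hχ, smul_left_injective F hw'0 (hα.symm.trans (one_smul F w').symm), one_smul,
    LinearMap.id_apply]

end Local

theorem isLieAutomorphism_of_isLocal (hn : 1 ≤ n)
    {Φ : WittLieAlgebra F n → WittLieAlgebra F n} (hΦ : IsLocalAutomorphism F Φ) :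
    IsLieAutomorphism F Φ := by
  obtain ⟨hlin, hloc⟩ := hΦ
  obtain ⟨w, hinj, -⟩ := exists_trivial_stabilizer (F := F) hn
  obtain ⟨θ₀, h₀⟩ := hloc (∑ γ ∈ simplexPoints n, E γ w)
  have := local_eq_id hn (Ψ := θ₀.symm.toLinearEquiv.toLinearMap ∘ₗ hlin.mk' Φ) (fun x => by
    obtain ⟨θ, h⟩ := hloc x
    exact ⟨θ.trans θ₀.symm, congrArg θ₀.symm h⟩) hinj
    ((congrArg θ₀.symm h₀).trans (θ₀.symm_apply_apply _))
  refine ⟨θ₀, fun x => ?_⟩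
  have hx : θ₀.symm (Φ x) = x := LinearMap.congr_fun this x
  rw [← θ₀.apply_symm_apply (Φ x), hx]

end

end WittLieAlgebra

theorem mainTheorem4 {F : Type*} [Field F] [CharZero F] (n : ℕ) (hn : 1 ≤ n) :
    (∀ Φ : WittLieAlgebra F n → WittLieAlgebra F n,
      IsTwoLocalAutomorphism F Φ → IsLieAutomorphism F Φ) ∧
    (∀ Φ : WittLieAlgebra F n → WittLieAlgebra F n,
      IsLocalAutomorphism F Φ → IsLieAutomorphism F Φ) :=
  ⟨fun _ h => WittLieAlgebra.isLieAutomorphism_of_isTwoLocal hn h,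
    fun _ h => WittLieAlgebra.isLieAutomorphism_of_isLocal hn h⟩
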